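/- Let $F \subseteq K \subseteq L$ be fields and let $\sigma : L \to L$ be an automorphism such that the triple $(F,K,L)$ is $\sigma$-admissible: $\sigma$ restricts to automorphisms of $F$ and of $K$; $F = F^\sigma = K^\sigma = L^\sigma$ (fixed elements of $\sigma$); and $L$ is a separable (not necessarily algebraic) extension of $K$. Let $\Phi \in \mathrm{GL}_r(K)$ and $\Psi \in \mathrm{GL}_r(L)$ satisfy $\sigma(\Psi) = \Phi\Psi$, where $\sigma$ is applied to the entries. For a commutative ring $R$ let $\mathrm{GL}_{r/R} = \operatorname{Spec} R[X, 1/\det X]$, $X=(X_{ij})$ an $r \times r$ matrix of independent variables, be the $R$-group scheme of invertible $r\times r$ matrices. Let $\Sigma = K[\Psi, 1/\det\Psi] \subseteq L$ be the image of the $K$-algebra map $\nu : K[X,1/\det X] \to L$, $X_{ij} \mapsto \Psi_{ij}$, and let $Z = Z_\Psi = \operatorname{Spec} \Sigma$, a closed $K$-subscheme of $\mathrm{GL}_{r/K}$. Let $\Psi_1, \Psi_2 \in \mathrm{GL}_r(L \otimes_K L)$ be the matrices with entries $(\Psi_1)_{ij} = \Psi_{ij} \otimes 1$ and $(\Psi_2)_{ij}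 = 1 \otimes \Psi_{ij}$, put $\widetilde\Psi = \Psi_1^{-1}\Psi_2$, let $\Delta$ be the image of the $F$-algebra map $\mu : F[X,1/\det X] \to L \otimes_K L$, $X_{ij} \mapsto \widetilde\Psi_{ij}$, and let $\Gamma = \Gamma_\Psi = \operatorname{Spec}\Delta$, a closed $F$-subscheme of $\mathrm{GL}_{r/F}$. Then $\Gamma$ is a closed $F$-subgroup scheme of $\mathrm{GL}_{r/F}$. Moreover the closed $K$-subscheme $Z$ of $\mathrm{GL}_{r/K}$ is stable under right multiplication by the base extension $\Gamma_K = \operatorname{Spec} K \times_{\operatorname{Spec} F} \Gamma \subseteq \mathrm{GL}_{r/K}$, and with this action it is a $\Gamma_K$-torsor: $Z$ is faithfully flat and of finite presentation over $K$, and $(z,\gamma) \mapsto (z, z\gamma)$ is an isomorphism $Z \times_K \Gamma_K \to Z \times_K Z$. -/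

import Mathlib

open AlgebraicGeometry CategoryTheory MonoidalCategory CartesianMonoidalCategory
open scoped TensorProduct MonObj

universe u v w

namespace DifferenceGalois

/-! ### The coordinate ring `R[X, 1/det X]` of `GL_r` -/

/-- The coordinate ring `R[X, 1/det X]` of `GL_{r/R}`, with `X` an `r × r` matrix of independent
variables. -/
abbrev GLRing (R : Type u) [CommRing R] (r : ℕ) : Type u :=
  Localization.Away (Matrix.mvPolynomialX (Fin r) (Fin r) R).det

/-- The universal invertible matrix `X` over `R[X, 1/det X]`. -/
noncomputable def univGL (R : Type u) [CommRing R] (r : ℕ) : GL (Fin r) (GLRing R r) :=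
  Matrix.GeneralLinearGroup.mk''
    ((Matrix.mvPolynomialX (Fin r) (Fin r) R).map
      (algebraMap (MvPolynomial (Fin r × Fin r) R) (GLRing R r)))
    (by
      have h := IsLocalization.Away.algebraMap_isUnit (S := GLRing R r)
        (Matrix.mvPolynomialX (Fin r) (Fin r) R).det
      rw [RingHom.map_det] at h
      exact h)

/-- For `g ∈ GL_r(S)`, the evaluation `R[X, 1/det X] → S`, `X ↦ g`. -/
noncomputable def evalGL {R : Type u} [CommRing R] {r : ℕ} {S : Type v} [CommRing S] [Algebra R S]
    (g : GL (Fin r) S) : GLRing R r →ₐ[R] S :=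
  IsLocalization.liftAlgHom
    (M := Submonoid.powers (Matrix.mvPolynomialX (Fin r) (Fin r) R).det)
    (f := MvPolynomial.aeval fun ij : Fin r × Fin r => (g : Matrix (Fin r) (Fin r) S) ij.1 ij.2)
    (by
      rintro ⟨_, n, rfl⟩
      rw [map_pow, AlgHom.map_det, Matrix.mvPolynomialX_mapMatrix_aeval]
      exact ((Matrix.isUnit_iff_isUnit_det _).mp g.isUnit).pow n)

/-- The value of `evalGL g` on the coordinate function `X i j`. -/
theorem evalGL_univGL {R : Type u} [CommRing R] {r : ℕ} {S : Type v} [CommRing S] [Algebra R S]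
    (g : GL (Fin r) S) (i j : Fin r) :
    evalGL (R := R) g ((univGL R r : Matrix (Fin r) (Fin r) (GLRing R r)) i j) =
      (g : Matrix (Fin r) (Fin r) S) i j := by
  simp [univGL, evalGL, Matrix.GeneralLinearGroup.mk'', Matrix.nonsingInvUnit]

/-- An `R`-algebra map out of `R[X, 1/det X]` is determined by the image of `X`. -/
theorem GLRing.algHom_ext {R : Type u} [CommRing R] {r : ℕ} {S : Type v} [CommRing S] [Algebra R S]
    {f g : GLRing R r →ₐ[R] S}
    (h : ∀ i j, f ((univGL R r : Matrix (Fin r) (Fin r) (GLRing R r)) i j) =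
      g ((univGL R r : Matrix (Fin r) (Fin r) (GLRing R r)) i j)) : f = g := by
  apply AlgHom.coe_ringHom_injective
  apply IsLocalization.ringHom_ext (R := MvPolynomial (Fin r × Fin r) R)
    (Submonoid.powers (Matrix.mvPolynomialX (Fin r) (Fin r) R).det)
  apply MvPolynomial.ringHom_ext
  · intro a
    have e : algebraMap (MvPolynomial (Fin r × Fin r) R) (GLRing R r) (MvPolynomial.C a) =
        algebraMap R (GLRing R r) a := by
      rw [IsScalarTower.algebraMap_apply R (MvPolynomial (Fin r × Fin r) R) (GLRing R r)]
      rfl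
    simp [e]
  · intro ij
    simpa [univGL, Matrix.GeneralLinearGroup.mk'', Matrix.nonsingInvUnit] using h ij.1 ij.2

/-- The comultiplication `X ↦ (X ⊗ 1) (1 ⊗ X)`. -/
noncomputable def comulGL (R : Type u) [CommRing R] (r : ℕ) :
    GLRing R r →ₐ[R] GLRing R r ⊗[R] GLRing R r :=
  evalGL (Matrix.GeneralLinearGroup.map
      ((Algebra.TensorProduct.includeLeft : GLRing R r →ₐ[R] GLRing R r ⊗[R] GLRing R r) :
        GLRing R r →+* GLRing R r ⊗[R] GLRing R r) (univGL R r) *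
    Matrix.GeneralLinearGroup.map
      ((Algebra.TensorProduct.includeRight : GLRing R r →ₐ[R] GLRing R r ⊗[R] GLRing R r) :
        GLRing R r →+* GLRing R r ⊗[R] GLRing R r) (univGL R r))

theorem comulGL_univGL (R : Type u) [CommRing R] (r : ℕ) (i j : Fin r) :
    comulGL R r ((univGL R r : Matrix (Fin r) (Fin r) (GLRing R r)) i j) =
      ∑ k, (univGL R r : Matrix (Fin r) (Fin r) (GLRing R r)) i k ⊗ₜ[R]
        (univGL R r : Matrix (Fin r) (Fin r) (GLRing R r)) k j := by
  rw [comulGL, evalGL_univGL]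
  simp [Matrix.mul_apply]

/-- The bialgebra structure on `R[X, 1/det X]` for which `X ↦ (X ⊗ 1) (1 ⊗ X)` is the
comultiplication and `X ↦ 1` is the counit. -/
noncomputable instance instBialgebraGLRing (R : Type u) [CommRing R] (r : ℕ) :
    Bialgebra R (GLRing R r) :=
  Bialgebra.ofAlgHom (comulGL R r) (evalGL 1)
    (by
      refine GLRing.algHom_ext (S := GLRing R r ⊗[R] (GLRing R r ⊗[R] GLRing R r)) fun i j => ?_
      simp only [AlgHom.comp_apply, comulGL_univGL, map_sum, Algebra.TensorProduct.map_tmul,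
        AlgHom.id_apply, TensorProduct.sum_tmul, TensorProduct.tmul_sum]
      rw [Finset.sum_comm]
      rfl)
    (by
      refine GLRing.algHom_ext (S := R ⊗[R] GLRing R r) fun i j => ?_
      simp [comulGL_univGL, evalGL_univGL, Matrix.one_apply, TensorProduct.ite_tmul])
    (by
      refine GLRing.algHom_ext (S := GLRing R r ⊗[R] R) fun i j => ?_
      simp [comulGL_univGL, evalGL_univGL, Matrix.one_apply, TensorProduct.tmul_ite])

theorem comulAlgHom_univGL (R : Type u) [CommRing R] (r : ℕ) (i j : Fin r) :
    Bialgebra.comulAlgHom R (GLRing R r)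
        ((univGL R r : Matrix (Fin r) (Fin r) (GLRing R r)) i j) =
      ∑ k, (univGL R r : Matrix (Fin r) (Fin r) (GLRing R r)) i k ⊗ₜ[R]
        (univGL R r : Matrix (Fin r) (Fin r) (GLRing R r)) k j :=
  comulGL_univGL R r i j

theorem counitAlgHom_univGL (R : Type u) [CommRing R] (r : ℕ) (i j : Fin r) :
    Bialgebra.counitAlgHom R (GLRing R r)
        ((univGL R r : Matrix (Fin r) (Fin r) (GLRing R r)) i j) =
      (1 : Matrix (Fin r) (Fin r) R) i j :=
  evalGL_univGL 1 i j

/-- The Hopf algebra structure on `R[X, 1/det X]`, with antipode `X ↦ X⁻¹`. By means of it,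
`GL_{r/R} = Spec R[X, 1/det X]` is an `R`-group scheme. -/
noncomputable instance instHopfAlgebraGLRing (R : Type u) [CommRing R] (r : ℕ) :
    HopfAlgebra R (GLRing R r) :=
  HopfAlgebra.ofAlgHom (evalGL (univGL R r)⁻¹)
    (by
      refine GLRing.algHom_ext (S := GLRing R r) fun i j => ?_
      have h := congrArg (fun m : GL (Fin r) (GLRing R r) =>
        (m : Matrix (Fin r) (Fin r) (GLRing R r)) i j) (inv_mul_cancel (univGL R r))
      simp only [Units.val_mul, Matrix.mul_apply, Units.val_one] at h
      simp only [AlgHom.comp_apply, comulAlgHom_univGL, counitAlgHom_univGL, map_sum]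
      refine (Finset.sum_congr rfl fun k _ => Algebra.TensorProduct.lift_tmul _ _ _ _ _).trans ?_
      simp only [evalGL_univGL, AlgHom.id_apply, h, Matrix.one_apply,
        apply_ite (Algebra.ofId R (GLRing R r)), map_one, map_zero])
    (by
      refine GLRing.algHom_ext (S := GLRing R r) fun i j => ?_
      have h := congrArg (fun m : GL (Fin r) (GLRing R r) =>
        (m : Matrix (Fin r) (Fin r) (GLRing R r)) i j) (mul_inv_cancel (univGL R r))
      simp only [Units.val_mul, Matrix.mul_apply, Units.val_one] at h
      simp only [AlgHom.comp_apply, comulAlgHom_univGL, counitAlgHom_univGL, map_sum]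
      refine (Finset.sum_congr rfl fun k _ => Algebra.TensorProduct.lift_tmul _ _ _ _ _).trans ?_
      simp only [evalGL_univGL, AlgHom.id_apply, h, Matrix.one_apply,
        apply_ite (Algebra.ofId R (GLRing R r)), map_one, map_zero])

/-! ### Schemes -/

/-- The affine `R`-scheme `Spec A` of an `R`-algebra `A`. -/
noncomputable abbrev specOver (R A : Type u) [CommRing R] [CommRing A] [Algebra R A] :
    Over (Spec (.of R)) :=
  (Spec (.of A)).asOver (Spec (.of R))

/-- The morphism of `R`-schemes `Spec B ⟶ Spec A` of an `R`-algebra map `A → B`. -/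
noncomputable abbrev specOverMap {R A B : Type u} [CommRing R] [CommRing A] [CommRing B]
    [Algebra R A] [Algebra R B] (f : A →ₐ[R] B) : specOver R B ⟶ specOver R A :=
  (Spec.map (CommRingCat.ofHom f.toRingHom)).asOver (Spec (.of R))

/-- The `R`-group scheme `GL_{r/R}`. -/
noncomputable def GLScheme (R : Type u) [CommRing R] (r : ℕ) : Over (Spec (.of R)) :=
  specOver R (GLRing R r)

/-- The group structure of `GL_{r/R}`, given on coordinate rings by `X ↦ (X ⊗ 1) (1 ⊗ X)`. -/
noncomputable instance instGrpObjGLScheme (R : Type u) [CommRing R] (r : ℕ) :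
    GrpObj (GLScheme R r) :=
  inferInstanceAs (GrpObj ((Spec (.of (GLRing R r))).asOver (Spec (.of R))))

/-- The base extension `X_S = Spec S ×_{Spec R} X` of an `R`-scheme `X` to an `S`-scheme, as a
functor. -/
noncomputable abbrev baseExt (R S : Type u) [CommRing R] [CommRing S] [Algebra R S] :
    Over (Spec (.of R)) ⥤ Over (Spec (.of S)) :=
  Over.pullback (Spec.map (CommRingCat.ofHom (algebraMap R S)))

/-- The canonical identification of the base extension of `GL_{r/R}` to `S` with `GL_{r/S}`: it is
the base change isomorphism onto `Spec (S ⊗[R] R[X, 1/det X])`, followed by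
the map given on coordinate rings by `X ↦ 1 ⊗ X`. -/
noncomputable def baseExtGL (R S : Type u) [CommRing R] [CommRing S] [Algebra R S] (r : ℕ) :
    (baseExt R S).obj (GLScheme R r) ⟶ GLScheme S r :=
  (Limits.pullbackSymmetry .. ≪≫ pullbackSpecIso' R S (GLRing R r)).hom.asOver (Spec (.of S)) ≫
    specOverMap (R := S) (A := GLRing S r) (B := S ⊗[R] GLRing R r)
      (evalGL (Matrix.GeneralLinearGroup.map
        ((Algebra.TensorProduct.includeRight : GLRing R r →ₐ[R] S ⊗[R] GLRing R r) :
          GLRing R r →+* S ⊗[R] GLRing R r) (univGL R r)))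

/-- `j : H ⟶ G` exhibits the group scheme `H` as a closed subgroup scheme of `G`. -/
structure IsClosedSubgroupScheme {S : Scheme.{u}} {H G : Over S} [GrpObj H] [GrpObj G]
    (j : H ⟶ G) : Prop where
  isClosedImmersion : IsClosedImmersion j.left
  isMonHom : IsMonHom j

/-- The morphism `a : X ×_S G ⟶ X` is a right action of the `S`-group scheme `G` on `X`, and it
makes `X` a (right) `G`-torsor for the fppf topology: `X` is faithfully flat and locally of finite
presentation over `S`, and `(x, g) ↦ (x, x g)` is an isomorphism `X ×_S G ⟶ X ×_S X`. -/
structure IsRightTorsor {S : Scheme.{u}} (G X : Over S) [GrpObj G] (a : X ⊗ G ⟶ X) : Prop where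
  act_one : X ◁ η[G] ≫ a = (ρ_ X).hom
  act_mul : X ◁ μ[G] ≫ a = (α_ X G G).inv ≫ a ▷ G ≫ a
  flat : Flat X.hom
  surjective : Surjective X.hom
  locallyOfFinitePresentation : LocallyOfFinitePresentation X.hom
  isIso : IsIso (lift (fst X G) a)

/-! ### The difference Galois setting -/

section

variable (F K L : Type u) [Field F] [Field K] [Field L] [Algebra F K] [Algebra K L] [Algebra F L]
  [IsScalarTower F K L]

/-- A tower of fields `F ⊆ K ⊆ L` with an automorphism `σ` of `L` is `σ`-admissible if
`σ` restricts to automorphisms of `F` and `K`, `F = F^σ = K^σ = L^σ`, and `L` is a separable (not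
necessarily algebraic) extension of `K`, i.e. geometrically reduced over `K`. -/
structure IsSigmaAdmissible (σ : L ≃+* L) : Prop where
  image_F : σ '' Set.range (algebraMap F L) = Set.range (algebraMap F L)
  image_K : σ '' Set.range (algebraMap K L) = Set.range (algebraMap K L)
  fixed_F : {x : L | x ∈ Set.range (algebraMap F L) ∧ σ x = x} = Set.range (algebraMap F L)
  fixed_K : {x : L | x ∈ Set.range (algebraMap K L) ∧ σ x = x} = Set.range (algebraMap F L)
  fixed_L : {x : L | σ x = x} = Set.range (algebraMap F L)
  separable : Algebra.IsGeometricallyReduced K L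

variable {L} {r : ℕ} (Ψ : GL (Fin r) L)

/-- `ν : K[X, 1/det X] → L`, `X ↦ Ψ`. -/
noncomputable def nu : GLRing K r →ₐ[K] L := evalGL Ψ

/-- `Σ = im ν = K[Ψ, 1/det Ψ] ⊆ L`. -/
noncomputable abbrev SigmaRing : Subalgebra K L := (nu K Ψ).range

/-- The `K`-scheme `Z_Ψ = Spec Σ`. -/
noncomputable def Z : Over (Spec (.of K)) := specOver K (SigmaRing K Ψ)

/-- The inclusion `Z_Ψ ⟶ GL_{r/K}`. -/
noncomputable def ZIncl : Z K Ψ ⟶ GLScheme K r := specOverMap (nu K Ψ).rangeRestrict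

/-- `Ψ̃ = Ψ₁⁻¹ Ψ₂ ∈ GL_r(L ⊗_K L)`, where `(Ψ₁)ᵢⱼ = Ψᵢⱼ ⊗ 1` and `(Ψ₂)ᵢⱼ = 1 ⊗ Ψᵢⱼ`. -/
noncomputable def PsiTilde : GL (Fin r) (L ⊗[K] L) :=
  (Matrix.GeneralLinearGroup.map
      ((Algebra.TensorProduct.includeLeft : L →ₐ[K] L ⊗[K] L) : L →+* L ⊗[K] L) Ψ)⁻¹ *
    Matrix.GeneralLinearGroup.map
      ((Algebra.TensorProduct.includeRight : L →ₐ[K] L ⊗[K] L) : L →+* L ⊗[K] L) Ψ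

/-- `μ : F[X, 1/det X] → L ⊗_K L`, `X ↦ Ψ̃`. -/
noncomputable def mu : GLRing F r →ₐ[F] L ⊗[K] L := evalGL (PsiTilde K Ψ)

/-- `Δ = im μ ⊆ L ⊗_K L`. -/
noncomputable abbrev DeltaRing : Subalgebra F (L ⊗[K] L) := (mu F K Ψ).range

/-- The `F`-scheme `Γ_Ψ = Spec Δ`. -/
noncomputable def Gam : Over (Spec (.of F)) := specOver F (DeltaRing F K Ψ)

/-- The inclusion `Γ_Ψ ⟶ GL_{r/F}`. -/
noncomputable def GamIncl : Gam F K Ψ ⟶ GLScheme F r := specOverMap (mu F K Ψ).rangeRestrict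

/-- The inclusion `(Γ_Ψ)_K ⟶ GL_{r/K}`. -/
noncomputable def GamBaseIncl : (baseExt F K).obj (Gam F K Ψ) ⟶ GLScheme K r :=
  (baseExt F K).map (GamIncl F K Ψ) ≫ baseExtGL F K r

end

end DifferenceGalois

/-!
The action of `σ` on `L` extends to the semilinear automorphism `σ ⊗ σ` of `L ⊗[K] L`, and
`σ(Ψ) = ΦΨ` says that the entries of `Ψ̃ = Ψ₁⁻¹ Ψ₂` are fixed by it; hence so is all of `Δ`. As
`L^σ = F`, a family of fixed elements that is linearly independent over `F` is linearly independent
over `L` (`linearIndependent_of_fixed`), so that `L ⊗[F] Δ → L ⊗[K] L` is injective. More generally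
`A ⊗[F] Δ → A ⊗[K] L` is injective for each `K`-algebra map `L → A` (`extendMap_injective`). All the
rest is a consequence of this injectivity.

* *`Γ` is a group.* A matrix in `GL_r(S)` defines a map `Δ → S` as soon as the map
  `F[X, 1/det X] → S` it defines kills `ker μ`, and for this it is enough to embed `S` in a ring `T`
  in which the matrix becomes an image of `Ψ̃` (`exists_algHom_of_mapGL_eq`). For the
  comultiplication, embed `Δ ⊗[F] Δ` in `L ⊗[K] L ⊗[K] L` and use
  `(Ψ₁⁻¹ Ψ₂) (Ψ₂⁻¹ Ψ₃) = Ψ₁⁻¹ Ψ₃`. For the counit and the antipode, use the multiplication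
  `L ⊗[K] L → L`, which sends `Ψ̃` to `1`, and the swap, which sends it to `Ψ̃⁻¹`.
* *`Z` is a torsor.* The rings `Σ ⊗[F] Δ` and `Σ ⊗[K] Σ` both embed in `L ⊗[K] L`, and
  `Ψ₂ = Ψ₁ Ψ̃` shows that the images agree (`exists_coaction`). The isomorphism
  `Σ ⊗[K] Σ → Σ ⊗[F] Δ` so obtained is dual to `(z, γ) ↦ (z, z γ)`.
* *Axioms of an action.* `Z → GL_{r/K}` is a monomorphism and `Γ_K → GL_{r/K}` is a homomorphism,
  so they follow from the group axioms of `GL_{r/K}`.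

Flatness and finite presentation are automatic, `Σ` being a finitely generated algebra over a field.
-/

namespace DifferenceGalois

/-! ### Evaluation maps -/

theorem comp_evalGL {R : Type u} [CommRing R] {r : ℕ} {S : Type v} [CommRing S] [Algebra R S]
    {S' : Type w} [CommRing S'] [Algebra R S'] (f : S →ₐ[R] S') (g : GL (Fin r) S) :
    f.comp (evalGL g) = evalGL (Matrix.GeneralLinearGroup.map (f : S →+* S') g) :=
  GLRing.algHom_ext fun i j => by simp [evalGL_univGL]

theorem map_evalGL_univGL {R : Type u} [CommRing R] {r : ℕ} {S : Type v} [CommRing S]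
    [Algebra R S] (g : GL (Fin r) S) :
    Matrix.GeneralLinearGroup.map ((evalGL g : GLRing R r →ₐ[R] S) : GLRing R r →+* S)
      (univGL R r) = g :=
  Matrix.GeneralLinearGroup.ext fun i j => by simp [evalGL_univGL]

theorem map_GL_congr {r : ℕ} {A B C : Type*} [CommRing A] [CommRing B] [CommRing C]
    (f : A →+* B) (g : B →+* C) (h : A →+* C) (H : g.comp f = h) (x : GL (Fin r) A) :
    Matrix.GeneralLinearGroup.map g (Matrix.GeneralLinearGroup.map f x) =
      Matrix.GeneralLinearGroup.map h x := by
  subst H; rfl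

/-- The group homomorphism `GL_r(A) → GL_r(B)` induced by an `R`-algebra map `A → B`. -/
abbrev mapGL {R A B : Type*} {r : ℕ} [CommRing R] [CommRing A] [CommRing B] [Algebra R A]
    [Algebra R B] (f : A →ₐ[R] B) : GL (Fin r) A →* GL (Fin r) B :=
  Matrix.GeneralLinearGroup.map (f : A →+* B)

/-! ### Linear independence of fixed elements -/

/-- Artin's argument: for a `σ`-semilinear additive endomorphism `τ` of an `L`-module, elements
fixed by `τ` that are linearly independent over `F = L^σ` are linearly independent over `L`. -/
theorem linearIndependent_of_fixed {F L M : Type*} [Field F] [Field L] [Algebra F L]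
    [AddCommGroup M] [Module L M] [Module F M] [IsScalarTower F L M] (σ : L ≃+* L)
    (hF : ∀ x : L, σ x = x → x ∈ Set.range (algebraMap F L)) (τ : M →+ M)
    (hτ : ∀ (c : L) (m : M), τ (c • m) = σ c • τ m) {J : Type*} {b : J → M}
    (hb : ∀ i, τ (b i) = b i) (hli : LinearIndependent F b) : LinearIndependent L b := by
  classical
  rw [linearIndependent_iff_finset_linearIndependent]
  intro s
  induction s using Finset.induction_on with
  | empty => exact linearIndependent_empty_type
  | insert a s ha ih =>
    change LinearIndepOn L b (↑(insert a s) : Set J)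
    rw [Finset.coe_insert]
    have ih' : LinearIndepOn L b (↑s : Set J) := ih
    refine ih'.insert fun hmem => ?_
    obtain ⟨c, hc⟩ := (Submodule.mem_span_image_finset_iff_exists_fun' L).mp hmem
    -- Applying `τ` to the relation and comparing coefficients shows that they are fixed by `σ`.
    have hc' : ∑ i ∈ s, σ (c i) • b i = b a := by
      have := congrArg τ hc
      simpa only [map_sum, hτ, hb] using this
    have hfix : ∀ i ∈ s, σ (c i) = c i :=
      linearIndepOn_finset_iffₛ.mp ih' _ _ (hc'.trans hc.symm)
    choose d hd using fun i : s => hF _ (hfix i.1 i.2)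
    have hmemF : b a ∈ Submodule.span F (b '' (↑s : Set J)) := by
      refine (Submodule.mem_span_image_finset_iff_exists_fun F).mpr ⟨d, ?_⟩
      rw [← hc, ← Finset.sum_coe_sort s]
      exact Finset.sum_congr rfl fun i _ => by
        rw [← hd i, algebraMap_smul]
    exact (hli.linearIndepOn (insert a (↑s : Set J))).notMem_span_of_insert
      (by simpa using ha) hmemF

/-- Two ring homomorphisms out of `L` that agree on `K` define one out of `L ⊗[K] L`, without a
`K`-algebra structure on the target being given: `σ ⊗ σ` is not `K`-linear. -/
theorem exists_ringHom_tensor {K L S : Type*} [CommRing K] [CommRing L] [CommRing S] [Algebra K L]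
    (f g : L →+* S) (h : f.comp (algebraMap K L) = g.comp (algebraMap K L)) :
    ∃ t : L ⊗[K] L →+* S, ∀ a b, t (a ⊗ₜ b) = f a * g b := by
  let : Algebra K S := (f.comp (algebraMap K L)).toAlgebra
  let f' : L →ₐ[K] S := { f with commutes' := fun k => rfl }
  let g' : L →ₐ[K] S := { g with commutes' := fun k => (RingHom.congr_fun h k).symm }
  exact ⟨(Algebra.TensorProduct.lift f' g' fun _ _ => Commute.all _ _).toRingHom,
    fun a b => Algebra.TensorProduct.lift_tmul ..⟩

theorem injective_of_basis {A V W J : Type*} [CommRing A] [AddCommGroup V] [Module A V]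
    [AddCommGroup W] [Module A W] (B : Module.Basis J A V) (f : V →ₗ[A] W)
    (h : LinearIndependent A fun i => f (B i)) : Function.Injective f := by
  have : (f : V → W) = Finsupp.linearCombination A (fun i => f (B i)) ∘ B.repr := by
    ext x
    conv_lhs => rw [← B.linearCombination_repr x]
    simp [Finsupp.linearCombination_apply, Finsupp.sum, map_sum]
  rw [this]
  exact Function.Injective.comp h B.repr.injective

section

variable {F K L D : Type u} [Field F] [Field K] [Field L] [Algebra F K] [Algebra K L] [Algebra F L]
  [IsScalarTower F K L] [CommRing D] [Algebra F D] (d : D →ₐ[F] L ⊗[K] L)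
  {A : Type v} [CommRing A] [Algebra F A] [Algebra K A] [IsScalarTower F K A] (q : L →ₐ[K] A)

/-- The map `A ⊗[F] D → A ⊗[K] L`, `a ⊗ x ↦ (a ⊗ 1) · (q ⊗ id) (d x)`. -/
noncomputable def extendMap : A ⊗[F] D →ₐ[A] A ⊗[K] L :=
  Algebra.TensorProduct.lift (Algebra.ofId A (A ⊗[K] L))
    (((Algebra.TensorProduct.map q (AlgHom.id K L)).restrictScalars F).comp d)
    fun _ _ => Commute.all _ _

theorem extendMap_tmul (a : A) (x : D) : extendMap d q (a ⊗ₜ x) =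
    (a ⊗ₜ 1) * Algebra.TensorProduct.map q (AlgHom.id K L) (d x) :=
  Algebra.TensorProduct.lift_tmul ..

/-- An `F`-basis of `D` is carried to a family that is linearly independent over `L`, hence, by the
flat base change `L → A`, to one in `A ⊗[L] (L ⊗[K] L) = A ⊗[K] L` that is so over `A`. -/
theorem extendMap_injective (hD : ∀ (J : Type u) (b : J → D),
      LinearIndependent F b → LinearIndependent L fun i => d (b i)) :
    Function.Injective (extendMap d q) := by
  let B := Module.Free.chooseBasis F D
  refine injective_of_basis (B.baseChange A) (extendMap d q).toLinearMap ?_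
  let : Algebra L A := q.toRingHom.toAlgebra
  have : IsScalarTower K L A := IsScalarTower.of_algebraMap_eq fun k => (q.commutes k).symm
  have hA : LinearIndependent A fun i => ((1 : A) ⊗ₜ[L] d (B i)) :=
    Module.Flat.linearIndependent_one_tmul (hD _ B B.linearIndependent)
  have := hA.map' (TensorProduct.AlgebraTensorModule.cancelBaseChange K L A A L).toLinearMap
    (LinearEquiv.ker _)
  have key : ∀ m : L ⊗[K] L, Algebra.TensorProduct.map q (AlgHom.id K L) m =
      TensorProduct.AlgebraTensorModule.cancelBaseChange K L A A L ((1 : A) ⊗ₜ[L] m) := by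
    intro m
    induction m with
    | zero => simp
    | add x y hx hy => simp only [map_add, TensorProduct.tmul_add, hx, hy]
    | tmul x y =>
      simp [Algebra.smul_def]
      rfl
  have hfun : (fun i => (extendMap d q).toLinearMap (B.baseChange A i)) =
      (TensorProduct.AlgebraTensorModule.cancelBaseChange K L A A L).toLinearMap ∘
        fun i => (1 : A) ⊗ₜ[L] d (B i) := by
    funext i
    simpa [extendMap_tmul, ← Algebra.TensorProduct.one_def] using key (d (B i))
  rw [hfun]
  exact this

end

/-! ### The entries of `Ψ₁⁻¹ Ψ₂` are fixed by `σ ⊗ σ` -/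

section

variable {F K L : Type u} [Field F] [Field K] [Field L] [Algebra F K] [Algebra K L] [Algebra F L]
  [IsScalarTower F K L] {r : ℕ}

/-- The image of `Ψ₁⁻¹ Ψ₂` under a ring homomorphism `t` is computed from the two restrictions of
`t` to `L`. -/
theorem map_PsiTilde (Ψ : GL (Fin r) L) {S : Type*} [CommRing S] (t : L ⊗[K] L →+* S)
    (f g : L →+* S) (hf : ∀ a, t (a ⊗ₜ 1) = f a) (hg : ∀ a, t (1 ⊗ₜ a) = g a) :
    Matrix.GeneralLinearGroup.map t (PsiTilde K Ψ) =
      (Matrix.GeneralLinearGroup.map f Ψ)⁻¹ * Matrix.GeneralLinearGroup.map g Ψ := by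
  rw [PsiTilde, map_mul, map_inv, map_GL_congr _ t f (RingHom.ext hf),
    map_GL_congr _ t g (RingHom.ext hg)]

theorem linearIndependent_of_mem_DeltaRing (σ : L ≃+* L) (hσ : IsSigmaAdmissible F K L σ)
    (Φ : GL (Fin r) K) (Ψ : GL (Fin r) L)
    (hΨ : Matrix.GeneralLinearGroup.map (σ : L →+* L) Ψ =
      Matrix.GeneralLinearGroup.map (algebraMap K L) Φ * Ψ)
    (J : Type u) (b : J → DeltaRing F K Ψ) (hb : LinearIndependent F b) :
    LinearIndependent L fun i => (b i : L ⊗[K] L) := by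
  let l : L →+* L ⊗[K] L := Algebra.TensorProduct.includeLeftRingHom
  let q : L →+* L ⊗[K] L := (Algebra.TensorProduct.includeRight : L →ₐ[K] L ⊗[K] L)
  have hlq : ∀ k : K, l (algebraMap K L k) = q (algebraMap K L k) := fun k =>
    Algebra.TensorProduct.tmul_one_eq_one_tmul k
  -- `τ = σ ⊗ σ` is well defined because `σ` maps `K` to itself.
  obtain ⟨τ, hτ⟩ := exists_ringHom_tensor (K := K) (l.comp (σ : L →+* L))
    (q.comp (σ : L →+* L)) (by
    ext k
    obtain ⟨k', hk'⟩ : σ (algebraMap K L k) ∈ Set.range (algebraMap K L) :=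
      hσ.image_K ▸ Set.mem_image_of_mem σ ⟨k, rfl⟩
    simp [← hk', hlq])
  have hσF : ∀ x : F, σ (algebraMap F L x) = algebraMap F L x := fun x =>
    (hσ.fixed_L.symm ▸ ⟨x, rfl⟩ : algebraMap F L x ∈ {x : L | σ x = x})
  let τF : L ⊗[K] L →ₐ[F] L ⊗[K] L :=
    { τ with
      commutes' := fun x => by
        change τ (algebraMap F L x ⊗ₜ 1) = algebraMap F L x ⊗ₜ 1
        simp [hτ, hσF, l, q] }
  have hτmu : τF.comp (mu F K Ψ) = mu F K Ψ := by
    rw [mu, comp_evalGL]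
    congr 1
    rw [map_PsiTilde Ψ _ (l.comp (σ : L →+* L)) (q.comp (σ : L →+* L))
        (fun a => by simp [τF, hτ]) (fun a => by simp [τF, hτ]),
      ← map_GL_congr (σ : L →+* L) l _ rfl, ← map_GL_congr (σ : L →+* L) q _ rfl, hΨ, map_mul,
      map_mul, map_GL_congr _ l _ rfl, map_GL_congr _ q _ rfl,
      show l.comp (algebraMap K L) = q.comp (algebraMap K L) from RingHom.ext hlq]
    rw [PsiTilde]
    change _ = (Matrix.GeneralLinearGroup.map l Ψ)⁻¹ * Matrix.GeneralLinearGroup.map q Ψ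
    group
  refine linearIndependent_of_fixed (F := F) σ (fun x hx => hσ.fixed_L ▸ hx) τ.toAddMonoidHom
    (fun c m => ?_) (fun i => ?_)
    (hb.map' (DeltaRing F K Ψ).val.toLinearMap (LinearMap.ker_eq_bot.mpr Subtype.val_injective))
  · change τ (c • m) = σ c • τ m
    rw [Algebra.smul_def, Algebra.smul_def, map_mul]
    congr 1
    change τ (c ⊗ₜ 1) = σ c ⊗ₜ 1
    simp [hτ, l]
  · obtain ⟨x, hx⟩ := (b i).2
    change τ (b i : L ⊗[K] L) = b i
    rw [← hx]
    exact DFunLike.congr_fun hτmu x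

end

/-! ### Quotients of the coordinate ring of `GL_r` -/

theorem algHom_ext_of_surjective_evalGL {R : Type u} {D : Type v} [CommRing R] [CommRing D]
    [Algebra R D] {r : ℕ} {X : GL (Fin r) D} (hX : Function.Surjective (evalGL (R := R) X))
    {S : Type w} [CommRing S] [Algebra R S] {f g : D →ₐ[R] S}
    (h : ∀ i j, f ((X : Matrix (Fin r) (Fin r) D) i j) =
      g ((X : Matrix (Fin r) (Fin r) D) i j)) : f = g := by
  have : f.comp (evalGL X) = g.comp (evalGL X) :=
    GLRing.algHom_ext fun i j => by simpa [evalGL_univGL] using h i j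
  exact AlgHom.ext (hX.forall.mpr (DFunLike.congr_fun this))

/-- Let `D` be a quotient of `R[X, 1/det X]`, with `X` now the image matrix in `GL_r(D)`. A matrix
`g ∈ GL_r(S)` comes from a map `D → S` if, in a ring `T` containing `S`, it becomes the image of `X`
under some map that factors through `D`. -/
theorem exists_algHom_of_mapGL_eq {R : Type u} {D : Type v} [CommRing R] [CommRing D]
    [Algebra R D] {r : ℕ} {X : GL (Fin r) D} (hX : Function.Surjective (evalGL (R := R) X))
    {S : Type w} [CommRing S] [Algebra R S] (g : GL (Fin r) S) {T M : Type*} [CommRing T]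
    [Algebra R T] [CommRing M] [Algebra R M] (d : D →ₐ[R] M) (j : S →ₐ[R] T)
    (hj : Function.Injective j) (t : M →ₐ[R] T) (h : mapGL j g = mapGL t (mapGL d X)) :
    ∃ f : D →ₐ[R] S, ∀ i j, f ((X : Matrix (Fin r) (Fin r) D) i j) =
        (g : Matrix (Fin r) (Fin r) S) i j := by
  have H : j.comp (evalGL g) = t.comp (d.comp (evalGL X)) := by
    rw [comp_evalGL, comp_evalGL, comp_evalGL, h]
  have hker : ∀ x, evalGL (R := R) X x = 0 → evalGL (R := R) g x = 0 := fun x hx => hj (by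
    rw [map_zero, ← AlgHom.comp_apply, H, AlgHom.comp_apply, AlgHom.comp_apply, hx, map_zero,
      map_zero])
  refine ⟨AlgHom.liftOfSurjective (evalGL X) hX (evalGL g) hker, fun i j => ?_⟩
  have := AlgHom.liftOfSurjective_apply (evalGL X) hX (evalGL g) hker
    ((univGL R r : Matrix (Fin r) (Fin r) (GLRing R r)) i j)
  rwa [evalGL_univGL, evalGL_univGL] at this

section Hopf

variable {R : Type u} {D : Type v} [CommRing R] [CommRing D] [Algebra R D] {r : ℕ}

/-- The Hopf algebra structure on a quotient `D` of `R[X, 1/det X]`, given by algebra maps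
`c`, `e`, `s` that have the same effect on the matrix of generators as the comultiplication, the
counit and the antipode of `R[X, 1/det X]`. -/
noncomputable abbrev hopfAlgebraOfSurjective (X : GL (Fin r) D)
    (hX : Function.Surjective (evalGL (R := R) X))
    (c : D →ₐ[R] D ⊗[R] D)
    (hc : ∀ i j, c ((X : Matrix (Fin r) (Fin r) D) i j) =
      ∑ k, (X : Matrix (Fin r) (Fin r) D) i k ⊗ₜ[R] (X : Matrix (Fin r) (Fin r) D) k j)
    (e : D →ₐ[R] R)
    (he : ∀ i j, e ((X : Matrix (Fin r) (Fin r) D) i j) = (1 : Matrix (Fin r) (Fin r) R) i j)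
    (s : D →ₐ[R] D)
    (hs : ∀ i j, s ((X : Matrix (Fin r) (Fin r) D) i j) =
      ((X⁻¹ : GL (Fin r) D) : Matrix (Fin r) (Fin r) D) i j) :
    HopfAlgebra R D :=
  letI : Bialgebra R D := Bialgebra.ofAlgHom c e
    (by
      refine algHom_ext_of_surjective_evalGL hX (S := D ⊗[R] (D ⊗[R] D)) fun i j => ?_
      simp only [AlgHom.comp_apply, hc, map_sum, Algebra.TensorProduct.map_tmul,
        AlgHom.id_apply, TensorProduct.sum_tmul, TensorProduct.tmul_sum]
      rw [Finset.sum_comm]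
      rfl)
    (by
      refine algHom_ext_of_surjective_evalGL hX (S := R ⊗[R] D) fun i j => ?_
      simp [hc, he, Matrix.one_apply, TensorProduct.ite_tmul])
    (by
      refine algHom_ext_of_surjective_evalGL hX (S := D ⊗[R] R) fun i j => ?_
      simp [hc, he, Matrix.one_apply, TensorProduct.tmul_ite])
  have hC : Bialgebra.comulAlgHom R D = c := rfl
  have hE : Bialgebra.counitAlgHom R D = e := rfl
  HopfAlgebra.ofAlgHom s
    (by
      refine algHom_ext_of_surjective_evalGL hX (S := D) fun i j => ?_
      have h := congrArg (fun m : GL (Fin r) D => (m : Matrix (Fin r) (Fin r) D) i j)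
        (inv_mul_cancel X)
      simp only [Units.val_mul, Matrix.mul_apply, Units.val_one] at h
      simp only [hC, hE, AlgHom.comp_apply, hc, he, map_sum]
      refine (Finset.sum_congr rfl fun k _ => Algebra.TensorProduct.lift_tmul _ _ _ _ _).trans ?_
      simp only [hs, AlgHom.id_apply, h, Matrix.one_apply, apply_ite (Algebra.ofId R D), map_one,
        map_zero])
    (by
      refine algHom_ext_of_surjective_evalGL hX (S := D) fun i j => ?_
      have h := congrArg (fun m : GL (Fin r) D => (m : Matrix (Fin r) (Fin r) D) i j)
        (mul_inv_cancel X)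
      simp only [Units.val_mul, Matrix.mul_apply, Units.val_one] at h
      simp only [hC, hE, AlgHom.comp_apply, hc, he, map_sum]
      refine (Finset.sum_congr rfl fun k _ => Algebra.TensorProduct.lift_tmul _ _ _ _ _).trans ?_
      simp only [hs, AlgHom.id_apply, h, Matrix.one_apply, apply_ite (Algebra.ofId R D), map_one,
        map_zero])

/-- `evalGL X` is a bialgebra map if the comultiplication and the counit of `D` take the same values
on `X` as those of `R[X, 1/det X]`. -/
theorem exists_bialgHom_evalGL {D : Type v} [CommRing D] [Bialgebra R D] {r : ℕ}
    (X : GL (Fin r) D)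
    (hc : ∀ i j, Bialgebra.comulAlgHom R D ((X : Matrix (Fin r) (Fin r) D) i j) =
      ∑ k, (X : Matrix (Fin r) (Fin r) D) i k ⊗ₜ[R] (X : Matrix (Fin r) (Fin r) D) k j)
    (he : ∀ i j, Bialgebra.counitAlgHom R D ((X : Matrix (Fin r) (Fin r) D) i j) =
      (1 : Matrix (Fin r) (Fin r) R) i j) :
    ∃ f : GLRing R r →ₐc[R] D, (f : GLRing R r →ₐ[R] D) = evalGL X :=
  ⟨BialgHom.ofAlgHom (evalGL X)
    (GLRing.algHom_ext fun i j => by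
      rw [AlgHom.comp_apply, evalGL_univGL, he, counitAlgHom_univGL])
    (GLRing.algHom_ext (S := D ⊗[R] D) fun i j => by
      simp only [AlgHom.comp_apply, comulAlgHom_univGL, map_sum, Algebra.TensorProduct.map_tmul,
        evalGL_univGL, hc]), rfl⟩

end Hopf

/-! ### The Hopf algebra structure on `Δ` -/

section

variable {F K L : Type u} [Field F] [Field K] [Field L] [Algebra F K] [Algebra K L] [Algebra F L]
  [IsScalarTower F K L] {D : Type u} [CommRing D] [Algebra F D] {r : ℕ}

variable {X : GL (Fin r) D} (hX : Function.Surjective (evalGL (R := F) X))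
  (d : D →ₐ[F] L ⊗[K] L) (Ψ : GL (Fin r) L) (hd : mapGL d X = PsiTilde K Ψ)

include hX hd

open Algebra.TensorProduct in
/-- The comultiplication is the corestriction to `D ⊗[F] D` of `x ⊗ y ↦ x ⊗ 1 ⊗ y`, from
`L ⊗[K] L` to `L ⊗[K] L ⊗[K] L`. -/
theorem exists_comul (hD : ∀ (J : Type u) (b : J → D), LinearIndependent F b →
      LinearIndependent L fun i => d (b i)) (hdi : Function.Injective d) :
    ∃ c : D →ₐ[F] D ⊗[F] D, ∀ i j, c ((X : Matrix (Fin r) (Fin r) D) i j) =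
      ∑ k, (X : Matrix (Fin r) (Fin r) D) i k ⊗ₜ[F] (X : Matrix (Fin r) (Fin r) D) k j := by
  let q : L →ₐ[K] L ⊗[K] L := includeRight
  let E := (extendMap d q).restrictScalars F
  let I : D ⊗[F] D →ₐ[F] (L ⊗[K] L) ⊗[F] D := map d (AlgHom.id F _)
  have hI : Function.Injective I :=
    Module.Flat.rTensor_preserves_injective_linearMap (M := D) d.toLinearMap hdi
  let t : L ⊗[K] L →ₐ[F] (L ⊗[K] L) ⊗[K] L :=
    (map (includeLeft : L →ₐ[K] L ⊗[K] L) (AlgHom.id K L)).restrictScalars F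
  let g : GL (Fin r) (D ⊗[F] D) :=
    mapGL (includeLeft : D →ₐ[F] D ⊗[F] D) X * mapGL (includeRight : D →ₐ[F] D ⊗[F] D) X
  -- The comparison with `Ψ₁⁻¹ Ψ₃` takes place in `L ⊗[K] L ⊗[K] L`, in which `D ⊗[F] D` embeds by
  -- `E.comp I`.
  suffices hg : mapGL (E.comp I) g = mapGL t (mapGL d X) by
    obtain ⟨c, hc⟩ := exists_algHom_of_mapGL_eq hX g d (E.comp I)
      ((extendMap_injective d q hD).comp hI) t hg
    refine ⟨c, fun i j => (hc i j).trans ?_⟩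
    simp [g, Matrix.mul_apply]
  let f₁ : L →+* (L ⊗[K] L) ⊗[K] L :=
    (includeLeftRingHom : L ⊗[K] L →+* (L ⊗[K] L) ⊗[K] L).comp includeLeftRingHom
  let f₂ : L →+* (L ⊗[K] L) ⊗[K] L :=
    (includeLeftRingHom : L ⊗[K] L →+* (L ⊗[K] L) ⊗[K] L).comp (q : L →+* L ⊗[K] L)
  let f₃ : L →+* (L ⊗[K] L) ⊗[K] L := (includeRight : L →ₐ[K] (L ⊗[K] L) ⊗[K] L)
  have h₁ : mapGL (E.comp I) (mapGL (includeLeft : D →ₐ[F] D ⊗[F] D) X) =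
      Matrix.GeneralLinearGroup.map
        (includeLeftRingHom : L ⊗[K] L →+* (L ⊗[K] L) ⊗[K] L) (PsiTilde K Ψ) := by
    rw [← hd, map_GL_congr _ _ _ rfl, map_GL_congr _ _ _ rfl]
    congr 2
    ext x
    simp [E, I, extendMap_tmul]
  have h₂ : mapGL (E.comp I) (mapGL (includeRight : D →ₐ[F] D ⊗[F] D) X) =
      Matrix.GeneralLinearGroup.map
        ((map q (AlgHom.id K L) : _ →ₐ[K] _) : L ⊗[K] L →+* (L ⊗[K] L) ⊗[K] L)
        (PsiTilde K Ψ) := by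
    rw [← hd, map_GL_congr _ _ _ rfl, map_GL_congr _ _ _ rfl]
    congr 2
    ext x
    simp [E, I, extendMap_tmul, ← Algebra.TensorProduct.one_def]
  rw [hd, map_PsiTilde Ψ _ f₁ f₃ (fun a => by simp [t, f₁]) (fun a => by simp [t, f₃]; rfl),
    map_mul, h₁, h₂, map_PsiTilde Ψ _ f₁ f₂ (fun a => rfl) (fun a => rfl),
    map_PsiTilde Ψ _ f₂ f₃ (fun a => by simp [f₂]) (fun a => by simp [f₃])]
  group

theorem exists_counit :
    ∃ e : D →ₐ[F] F, ∀ i j, e ((X : Matrix (Fin r) (Fin r) D) i j) =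
      (1 : Matrix (Fin r) (Fin r) F) i j := by
  refine exists_algHom_of_mapGL_eq hX 1 d (Algebra.ofId F L) (algebraMap F L).injective
    ((Algebra.TensorProduct.lmul' K : L ⊗[K] L →ₐ[K] L).restrictScalars F) ?_
  rw [hd, map_PsiTilde Ψ _ (RingHom.id L) (RingHom.id L) (fun a => by simp) (fun a => by simp)]
  simp

theorem exists_antipode (hdi : Function.Injective d) :
    ∃ s : D →ₐ[F] D, ∀ i j, s ((X : Matrix (Fin r) (Fin r) D) i j) =
      ((X⁻¹ : GL (Fin r) D) : Matrix (Fin r) (Fin r) D) i j := by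
  refine exists_algHom_of_mapGL_eq hX _ d d hdi
    ((Algebra.TensorProduct.comm K L L).toAlgHom.restrictScalars F) ?_
  rw [map_inv, hd, map_PsiTilde Ψ _ (Algebra.TensorProduct.includeRight : L →ₐ[K] L ⊗[K] L)
    Algebra.TensorProduct.includeLeftRingHom (fun a => by simp) (fun a => by simp),
    PsiTilde, mul_inv_rev, inv_inv]
  rfl

end

/-! ### Morphisms of affine schemes over `Spec R` -/

theorem isMonHom_specOverMap {R A B : Type u} [CommRing R] [CommRing A] [CommRing B]
    [Bialgebra R A] [Bialgebra R B] (f : A →ₐc[R] B) :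
    IsMonHom (specOverMap (f : A →ₐ[R] B)) :=
  ((bialgSpec (.of R)).map (.op (CommBialgCat.ofHom f))).isMonHom_hom

/-- The canonical morphism `Spec (A ⊗[R] B) ⟶ Spec A × Spec B`, which is an isomorphism. -/
noncomputable def tensorSpec (R A B : Type u) [CommRing R] [CommRing A] [CommRing B]
    [Algebra R A] [Algebra R B] : specOver R (A ⊗[R] B) ⟶ specOver R A ⊗ specOver R B :=
  lift (specOverMap Algebra.TensorProduct.includeLeft)
    (specOverMap Algebra.TensorProduct.includeRight)

theorem isIso_specOver {R : Type u} [CommRing R] {X Y : Over (Spec (.of R))} (f : X ⟶ Y)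
    (hf : IsIso f.left) : IsIso f :=
  have : IsIso ((Over.forget _).map f) := hf
  isIso_of_reflects_iso f (Over.forget _)

instance isIso_tensorSpec (R A B : Type u) [CommRing R] [CommRing A] [CommRing B]
    [Algebra R A] [Algebra R B] : IsIso (tensorSpec R A B) := by
  have h : (tensorSpec R A B).left = (pullbackSpecIso R A B).inv :=
    Limits.pullback.hom_ext
      ((congrArg Over.Hom.left (lift_fst _ _)).trans (pullbackSpecIso_inv_fst R A B).symm)
      ((congrArg Over.Hom.left (lift_snd _ _)).trans (pullbackSpecIso_inv_snd R A B).symm)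
  refine isIso_specOver _ ?_
  have : IsIso (pullbackSpecIso R A B).inv := inferInstance
  exact h ▸ this

theorem specOverMap_comp {R A B C : Type u} [CommRing R] [CommRing A] [CommRing B] [CommRing C]
    [Algebra R A] [Algebra R B] [Algebra R C] (f : A →ₐ[R] B) (g : B →ₐ[R] C) :
    specOverMap g ≫ specOverMap f = specOverMap (g.comp f) :=
  Over.OverMorphism.ext (Spec.map_comp (CommRingCat.ofHom f.toRingHom)
    (CommRingCat.ofHom g.toRingHom)).symm

theorem isIso_specOverMap {R A B : Type u} [CommRing R] [CommRing A] [CommRing B]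
    [Algebra R A] [Algebra R B] (f : A →ₐ[R] B) (hf : Function.Bijective f) :
    IsIso (specOverMap f) := by
  refine isIso_specOver _ ?_
  have : IsIso (CommRingCat.ofHom f.toRingHom) :=
    (ConcreteCategory.isIso_iff_bijective (CommRingCat.ofHom f.toRingHom)).mpr hf
  exact (inferInstance : IsIso (Spec.map (CommRingCat.ofHom f.toRingHom)))

/-- The morphism `Spec B ⟶ GL_{r/R}` given by a matrix `g ∈ GL_r(B)`. -/
noncomputable def pointGL (R : Type u) {B : Type u} [CommRing R] [CommRing B] [Algebra R B]
    {r : ℕ} (g : GL (Fin r) B) : specOver R B ⟶ GLScheme R r :=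
  specOverMap (evalGL g)

theorem specOverMap_comp_pointGL {R B C : Type u} [CommRing R] [CommRing B] [CommRing C]
    [Algebra R B] [Algebra R C] {r : ℕ} (f : B →ₐ[R] C) (g : GL (Fin r) B) :
    specOverMap f ≫ pointGL R g = pointGL R (mapGL f g) :=
  (specOverMap_comp _ _).trans (congrArg _ (comp_evalGL f g))

/-- The product of two points of `GL_{r/R}` is given by the product of matrices. -/
theorem lift_pointGL_mul {R B : Type u} [CommRing R] [CommRing B] [Algebra R B] {r : ℕ}
    (g h : GL (Fin r) B) :
    lift (pointGL R g) (pointGL R h) ≫ μ[GLScheme R r] = pointGL R (g * h) := by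
  have := (Spec.mapMulEquiv (R := R) (S := GLRing R r) (T := B)).map_mul
    (WithConv.toConv (evalGL g)) (WithConv.toConv (evalGL h))
  refine (Eq.symm this).trans ?_
  change specOverMap (WithConv.ofConv (WithConv.toConv (evalGL g) * WithConv.toConv (evalGL h) :
    WithConv (GLRing R r →ₐ[R] B))) = _
  congr 1
  refine GLRing.algHom_ext fun i j => ?_
  rw [AlgHom.convMul_def, AlgHom.comp_apply, AlgHom.comp_apply]
  rw [comulAlgHom_univGL, evalGL_univGL, map_sum, map_sum]
  simp [evalGL_univGL, Matrix.mul_apply]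

section

variable (F K D : Type u) [CommRing F] [CommRing K] [Algebra F K] [CommRing D] [Algebra F D]

/-- The canonical isomorphism `(Spec D)_K ⟶ Spec (K ⊗[F] D)`. -/
noncomputable def baseExtSpec : (baseExt F K).obj (specOver F D) ⟶ specOver K (K ⊗[F] D) :=
  (Limits.pullbackSymmetry .. ≪≫ pullbackSpecIso' F K D).hom.asOver (Spec (.of K))

instance isIso_baseExtSpec : IsIso (baseExtSpec F K D) :=
  isIso_specOver _
    (inferInstanceAs (IsIso (Limits.pullbackSymmetry .. ≪≫ pullbackSpecIso' F K D).hom))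

theorem baseExtSpec_left_comp_includeLeft :
    (baseExtSpec F K D).left ≫ Spec.map (CommRingCat.ofHom
      (Algebra.TensorProduct.includeLeftRingHom : K →+* K ⊗[F] D)) =
      Limits.pullback.snd (Spec.map (CommRingCat.ofHom (algebraMap F D)))
        (Spec.map (CommRingCat.ofHom (algebraMap F K))) := by
  refine (Category.assoc (Limits.pullbackSymmetry _ _).hom (pullbackSpecIso F K D).hom _).trans ?_
  rw [pullbackSpecIso_hom_fst]
  exact Limits.pullbackSymmetry_hom_comp_fst _ _

theorem baseExtSpec_left_comp_includeRight :
    (baseExtSpec F K D).left ≫ Spec.map (CommRingCat.ofHom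
      (Algebra.TensorProduct.includeRight : D →ₐ[F] K ⊗[F] D).toRingHom) =
      Limits.pullback.fst (Spec.map (CommRingCat.ofHom (algebraMap F D)))
        (Spec.map (CommRingCat.ofHom (algebraMap F K))) := by
  refine (Category.assoc (Limits.pullbackSymmetry _ _).hom (pullbackSpecIso F K D).hom _).trans ?_
  refine (congrArg _ (pullbackSpecIso_hom_snd F K D)).trans ?_
  exact Limits.pullbackSymmetry_hom_comp_snd _ _

variable {F K D}

theorem hom_ext_specTensor {T : Scheme.{u}} {f g : T ⟶ Spec (.of (K ⊗[F] D))}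
    (hl : f ≫ Spec.map (CommRingCat.ofHom
      (Algebra.TensorProduct.includeLeftRingHom : K →+* K ⊗[F] D)) = g ≫ Spec.map
        (CommRingCat.ofHom (Algebra.TensorProduct.includeLeftRingHom : K →+* K ⊗[F] D)))
    (hr : f ≫ Spec.map (CommRingCat.ofHom
      (Algebra.TensorProduct.includeRight : D →ₐ[F] K ⊗[F] D).toRingHom) = g ≫ Spec.map
        (CommRingCat.ofHom (Algebra.TensorProduct.includeRight : D →ₐ[F] K ⊗[F] D).toRingHom)) :
    f = g := by
  refine (cancel_mono (pullbackSpecIso F K D).inv).mp (Limits.pullback.hom_ext ?_ ?_)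
  · simpa only [Category.assoc, pullbackSpecIso_inv_fst] using hl
  · simp only [Category.assoc, pullbackSpecIso_inv_snd]
    exact hr

theorem baseExtSpec_naturality {E : Type u} [CommRing E] [Algebra F E] (f : D →ₐ[F] E) :
    (baseExt F K).map (specOverMap f) ≫ baseExtSpec F K D =
      baseExtSpec F K E ≫ specOverMap (Algebra.TensorProduct.map (AlgHom.id K K) f) := by
  refine Over.OverMorphism.ext (hom_ext_specTensor ?_ ?_)
  · have h : specOverMap (Algebra.TensorProduct.map (AlgHom.id K K) f) ≫
        specOverMap (Algebra.ofId K (K ⊗[F] D)) = specOverMap (Algebra.ofId K (K ⊗[F] E)) := by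
      rw [specOverMap_comp]
      congr 1
      ext
    refine (Category.assoc _ _ _).trans ?_
    refine (congrArg _ (baseExtSpec_left_comp_includeLeft F K D)).trans ?_
    refine Eq.trans ?_ (Category.assoc _ _ _).symm
    refine Eq.trans ?_ (congrArg (fun t : specOver K (K ⊗[F] E) ⟶ specOver K K =>
      (baseExtSpec F K E).left ≫ t.left) h).symm
    refine Eq.trans ?_ (baseExtSpec_left_comp_includeLeft F K E).symm
    exact Limits.pullback.lift_snd _ _ _
  · refine (Category.assoc _ _ _).trans ?_
    refine (congrArg _ (baseExtSpec_left_comp_includeRight F K D)).trans ?_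
    refine Eq.trans ?_ (Category.assoc _ _ _).symm
    have h : Spec.map (CommRingCat.ofHom (Algebra.TensorProduct.map (AlgHom.id K K) f).toRingHom) ≫
        Spec.map (CommRingCat.ofHom
          (Algebra.TensorProduct.includeRight : D →ₐ[F] K ⊗[F] D).toRingHom) =
        Spec.map (CommRingCat.ofHom
          (Algebra.TensorProduct.includeRight : E →ₐ[F] K ⊗[F] E).toRingHom) ≫
        Spec.map (CommRingCat.ofHom f.toRingHom) := by
      rw [← Spec.map_comp, ← Spec.map_comp]
      congr 1
    refine Eq.trans ?_ (congrArg (fun t => (baseExtSpec F K E).left ≫ t) h).symm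
    refine Eq.trans ?_ (Category.assoc _ _ _)
    refine Eq.trans ?_ (congrArg (fun t => t ≫ Spec.map (CommRingCat.ofHom f.toRingHom))
      (baseExtSpec_left_comp_includeRight F K E)).symm
    exact Limits.pullback.lift_fst _ _ _

end

theorem isMonHom_baseExtSpec (F K D : Type u) [CommRing F] [CommRing K] [Algebra F K] [CommRing D]
    [HopfAlgebra F D] :
    letI : GrpObj ((baseExt F K).obj (specOver F D)) := Functor.grpObjObj
    IsMonHom (baseExtSpec F K D) :=
  inferInstanceAs (IsMonHom
    ((Limits.pullbackSymmetry .. ≪≫ pullbackSpecIso' F K D).hom.asOver (Spec (.of K))))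

/-- The identification of the base extension of `GL_{r/R}` with `GL_{r/S}` respects the group
structures. -/
theorem isMonHom_baseExtGL (R S : Type u) [CommRing R] [CommRing S] [Algebra R S] (r : ℕ) :
    letI : GrpObj ((baseExt R S).obj (GLScheme R r)) := Functor.grpObjObj
    IsMonHom (baseExtGL R S r) := by
  let : GrpObj ((baseExt R S).obj (GLScheme R r)) := Functor.grpObjObj
  let X : GL (Fin r) (S ⊗[R] GLRing R r) := mapGL
    (Algebra.TensorProduct.includeRight : GLRing R r →ₐ[R] S ⊗[R] GLRing R r) (univGL R r)
  have hX : ∀ i j, (X : Matrix (Fin r) (Fin r) (S ⊗[R] GLRing R r)) i j = 1 ⊗ₜ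
    (univGL R r : Matrix (Fin r) (Fin r) (GLRing R r)) i j := fun _ _ => rfl
  obtain ⟨f, hf⟩ := exists_bialgHom_evalGL (R := S) X
    (fun i j => by
      have := RingHom.congr_fun (Bialgebra.comul_includeRight (R := R) (A := S)
        (B := GLRing R r)) ((univGL R r : Matrix (Fin r) (Fin r) (GLRing R r)) i j)
      refine this.trans ?_
      rw [RingHom.comp_apply]
      refine (congrArg _ (comulAlgHom_univGL R r i j)).trans ?_
      rw [map_sum]
      exact Finset.sum_congr rfl fun k _ => Algebra.TensorProduct.mapRingHom_tmul ..)
    (fun i j => by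
      have := AlgHom.congr_fun (Bialgebra.counitAlgHom_comp_includeRight (R := R) (A := S)
        (B := GLRing R r)) ((univGL R r : Matrix (Fin r) (Fin r) (GLRing R r)) i j)
      refine this.trans ?_
      rw [AlgHom.comp_apply, counitAlgHom_univGL]
      simp [Matrix.one_apply, apply_ite (Algebra.ofId R S)])
  let : GrpObj ((baseExt R S).obj (specOver R (GLRing R r))) := Functor.grpObjObj
  have h1 : IsMonHom (baseExtSpec R S (GLRing R r)) := isMonHom_baseExtSpec R S (GLRing R r)
  have h2 : IsMonHom (specOverMap (R := S) (evalGL (R := S) X)) :=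
    hf ▸ isMonHom_specOverMap f
  exact (inferInstance :
    IsMonHom (baseExtSpec R S (GLRing R r) ≫ specOverMap (R := S) (evalGL (R := S) X)))

/-! ### The coaction of `Δ` on `Σ` -/

section

variable {F K L : Type u} [Field F] [Field K] [Field L] [Algebra F K] [Algebra K L] [Algebra F L]
  [IsScalarTower F K L] {D S : Type u} [CommRing D] [Algebra F D] [CommRing S] [Algebra K S]
  [Algebra F S] [IsScalarTower F K S] {r : ℕ}
  {X : GL (Fin r) D} (hX : Function.Surjective (evalGL (R := F) X))
  (d : D →ₐ[F] L ⊗[K] L) {Ψ : GL (Fin r) L} (hd : mapGL d X = PsiTilde K Ψ)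
  {Y : GL (Fin r) S} (hY : Function.Surjective (evalGL (R := K) Y))
  (i : S →ₐ[K] L) (hi : Function.Injective i) (hiY : mapGL i Y = Ψ)

open Algebra.TensorProduct

include hX hd hY hi hiY in
/-- The coaction `ρ : Ψ ↦ (Ψ ⊗ 1) (1 ⊗ X)` and the induced isomorphism `S ⊗[K] S → S ⊗[F] D`. Both
sides embed in `L ⊗[K] L`; there `ρ` becomes `s ↦ 1 ⊗ s`, by `Ψ₂ = Ψ₁ Ψ̃`. -/
theorem exists_coaction (hD : ∀ (J : Type u) (b : J → D), LinearIndependent F b →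
      LinearIndependent L fun i => d (b i)) :
    ∃ ρ : S →ₐ[K] S ⊗[F] D,
      (∀ a b, ρ ((Y : Matrix (Fin r) (Fin r) S) a b) =
        ∑ k, (Y : Matrix (Fin r) (Fin r) S) a k ⊗ₜ (X : Matrix (Fin r) (Fin r) D) k b) ∧
      Function.Bijective
        (Algebra.TensorProduct.lift (includeLeft : S →ₐ[K] S ⊗[F] D) ρ fun _ _ => .all _ _) := by
  -- `θ : S ⊗[F] D → L ⊗[K] L`, `s ⊗ x ↦ (i s ⊗ 1) · d x`
  let θ : S ⊗[F] D →ₐ[K] L ⊗[K] L :=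
    ((extendMap d (AlgHom.id K L)).restrictScalars K).comp (map i (AlgHom.id F D))
  have hθ : Function.Injective θ :=
    (extendMap_injective d (AlgHom.id K L) hD).comp
      (Module.Flat.rTensor_preserves_injective_linearMap (M := D)
        (i.restrictScalars F).toLinearMap hi)
  have hθl : ∀ s, θ (s ⊗ₜ 1) = i s ⊗ₜ 1 := fun s => by simp [θ, extendMap_tmul]
  have hθr : ∀ x, θ (1 ⊗ₜ x) = d x := fun x => by
    simp [θ, extendMap_tmul, ← Algebra.TensorProduct.one_def]
  let ψ : S ⊗[K] S →ₐ[K] L ⊗[K] L := map i i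
  have hψ : Function.Injective ψ := by
    have h := (Module.Flat.lTensor_preserves_injective_linearMap (M := L) i.toLinearMap hi).comp
      (Module.Flat.rTensor_preserves_injective_linearMap (M := S) i.toLinearMap hi)
    rw [← LinearMap.coe_comp, LinearMap.lTensor_comp_rTensor] at h
    exact h
  let g : GL (Fin r) (S ⊗[F] D) :=
    mapGL (includeLeft : S →ₐ[F] S ⊗[F] D) Y * mapGL (includeRight : D →ₐ[F] S ⊗[F] D) X
  have hgl : mapGL θ (mapGL (includeLeft : S →ₐ[F] S ⊗[F] D) Y) =
      mapGL (includeLeft : L →ₐ[K] L ⊗[K] L) Ψ := by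
    rw [← hiY]
    exact Matrix.GeneralLinearGroup.ext fun a b => hθl _
  have hgr : mapGL θ (mapGL (includeRight : D →ₐ[F] S ⊗[F] D) X) = PsiTilde K Ψ := by
    rw [← hd]
    exact Matrix.GeneralLinearGroup.ext fun a b => hθr _
  have hg : mapGL θ g = mapGL (includeRight : L →ₐ[K] L ⊗[K] L) (mapGL i Y) := by
    rw [map_mul, hgl, hgr, hiY]
    exact mul_inv_cancel_left _ _
  obtain ⟨ρ, hρ⟩ := exists_algHom_of_mapGL_eq (R := K) hY g i θ hθ
    (includeRight : L →ₐ[K] L ⊗[K] L) hg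
  have hρ' : ∀ a b, ρ ((Y : Matrix (Fin r) (Fin r) S) a b) =
      ∑ k, (Y : Matrix (Fin r) (Fin r) S) a k ⊗ₜ (X : Matrix (Fin r) (Fin r) D) k b := by
    intro a b
    rw [hρ]
    simp [g, Matrix.mul_apply]
  refine ⟨ρ, hρ', ?_⟩
  set α := Algebra.TensorProduct.lift (includeLeft : S →ₐ[K] S ⊗[F] D) ρ fun _ _ => .all _ _
    with hα
  have hθρ : θ.comp ρ = (includeRight : L →ₐ[K] L ⊗[K] L).comp i := by
    refine algHom_ext_of_surjective_evalGL hY fun a b => ?_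
    rw [AlgHom.comp_apply, hρ]
    exact congrArg (fun m : GL (Fin r) (L ⊗[K] L) =>
      (m : Matrix (Fin r) (Fin r) (L ⊗[K] L)) a b) hg
  have hθα : θ.comp α = ψ := by
    apply Algebra.TensorProduct.ext
    · ext s
      simp [α, hθl, ψ]
    · ext s
      simpa [α, ψ, ← Algebra.TensorProduct.one_def] using AlgHom.congr_fun hθρ s
  constructor
  · have : Function.Injective (θ ∘ α) := by
      have := congrArg (fun f : S ⊗[K] S →ₐ[K] L ⊗[K] L => (f : S ⊗[K] S → L ⊗[K] L)) hθα
      exact (show (θ ∘ α : S ⊗[K] S → L ⊗[K] L) = ψ from this) ▸ hψ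
    exact this.of_comp
  · -- Conversely `Ψ̃ = Ψ₁⁻¹ Ψ₂` shows that `1 ⊗ x` is in the image.
    let W : GL (Fin r) (S ⊗[K] S) :=
      (mapGL (includeLeft : S →ₐ[K] S ⊗[K] S) Y)⁻¹ * mapGL (includeRight : S →ₐ[K] S ⊗[K] S) Y
    have hψW : mapGL (ψ.restrictScalars F) W = mapGL d X := by
      have hl : mapGL (ψ.restrictScalars F) (mapGL (includeLeft : S →ₐ[K] S ⊗[K] S) Y) =
          mapGL (includeLeft : L →ₐ[K] L ⊗[K] L) Ψ := by
        rw [← hiY]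
        exact Matrix.GeneralLinearGroup.ext fun a b => by simp [ψ]
      have hr : mapGL (ψ.restrictScalars F) (mapGL (includeRight : S →ₐ[K] S ⊗[K] S) Y) =
          mapGL (includeRight : L →ₐ[K] L ⊗[K] L) Ψ := by
        rw [← hiY]
        exact Matrix.GeneralLinearGroup.ext fun a b => by simp [ψ]
      rw [map_mul, map_inv, hl, hr, hd]
      rfl
    have hψd : (ψ.restrictScalars F).comp (evalGL W) = d.comp (evalGL X) := by
      rw [comp_evalGL, comp_evalGL]
      exact congrArg evalGL hψW
    intro y
    induction y with
    | zero => exact ⟨0, map_zero _⟩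
    | add y z hy hz =>
      obtain ⟨a, rfl⟩ := hy
      obtain ⟨b, rfl⟩ := hz
      exact ⟨a + b, map_add _ _ _⟩
    | tmul s x =>
      obtain ⟨z, rfl⟩ := hX x
      refine ⟨s ⊗ₜ 1 * evalGL W z, ?_⟩
      have h : α (evalGL W z) = 1 ⊗ₜ evalGL X z := hθ (by
        rw [hθr]
        exact (AlgHom.congr_fun hθα _).trans (AlgHom.congr_fun hψd z))
      rw [map_mul, h]
      simp [α]

end

/-! ### The action on the torsor -/

section Action

/-! A morphism `X ⊗ G ⟶ X` that a monomorphism `X ⟶ M` makes compatible with right multiplication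
by the image of `G` in the monoid object `M` satisfies the axioms of an action. -/

variable {C : Type*} [Category* C] [CartesianMonoidalCategory C] {M G X : C} [MonObj M] [MonObj G]
  (z : X ⟶ M) [Mono z] (j : G ⟶ M) [IsMonHom j] {a : X ⊗ G ⟶ X} (ha : a ≫ z = (z ⊗ₘ j) ≫ μ)

include ha

theorem whiskerLeft_one_comp_action : X ◁ η[G] ≫ a = (ρ_ X).hom := by
  rw [← cancel_mono z, Category.assoc, ha, ← id_tensorHom, tensorHom_comp_tensorHom_assoc,
    Category.id_comp, IsMonHom.one_hom, tensorHom_def_assoc, MonObj.mul_one, rightUnitor_naturality]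

theorem whiskerLeft_mul_comp_action : X ◁ μ[G] ≫ a = (α_ X G G).inv ≫ a ▷ G ≫ a := by
  rw [← cancel_mono z]
  simp only [Category.assoc, ha]
  have h₁ : X ◁ μ[G] ≫ (z ⊗ₘ j) = (z ⊗ₘ (j ⊗ₘ j)) ≫ M ◁ μ[M] := by
    rw [← id_tensorHom, ← id_tensorHom, tensorHom_comp_tensorHom, tensorHom_comp_tensorHom,
      IsMonHom.mul_hom, Category.id_comp, Category.comp_id]
  have h₂ : a ▷ G ≫ (z ⊗ₘ j) = ((z ⊗ₘ j) ⊗ₘ j) ≫ μ[M] ▷ M := by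
    rw [← tensorHom_id, ← tensorHom_id, tensorHom_comp_tensorHom, tensorHom_comp_tensorHom, ha,
      Category.id_comp, Category.comp_id]
  rw [reassoc_of% h₁, reassoc_of% h₂, MonObj.mul_assoc, associator_naturality_assoc,
    Iso.inv_hom_id_assoc]

end Action

section

variable {F K S D : Type u} [Field F] [Field K] [Algebra F K] [CommRing D] [Algebra F D]
  [CommRing S] [Algebra K S] [Algebra F S] [IsScalarTower F K S] {r : ℕ}
  {X : GL (Fin r) D} {Y : GL (Fin r) S}

/-- The base extension of the point `X` of `GL_{r/F}` is the point `1 ⊗ X` of `GL_{r/K}`. -/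
theorem baseExt_map_comp_baseExtGL :
    (baseExt F K).map (pointGL F X) ≫ baseExtGL F K r =
      baseExtSpec F K D ≫ pointGL K
        (mapGL (Algebra.TensorProduct.includeRight : D →ₐ[F] K ⊗[F] D) X) := by
  have h : mapGL (Algebra.TensorProduct.map (AlgHom.id K K) (evalGL (R := F) X))
      (mapGL (Algebra.TensorProduct.includeRight : GLRing F r →ₐ[F] K ⊗[F] GLRing F r)
        (univGL F r)) = mapGL (Algebra.TensorProduct.includeRight : D →ₐ[F] K ⊗[F] D) X :=
    Matrix.GeneralLinearGroup.ext fun i j => by simp [evalGL_univGL]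
  rw [← h, ← specOverMap_comp_pointGL, ← Category.assoc, ← baseExtSpec_naturality, Category.assoc]
  rfl

open Algebra.TensorProduct

/-- The right action of `(Spec D)_K` on `Spec S` that is given on rings by the coaction `ρ`. Here
`Spec S × (Spec D)_K` is identified with `Spec (S ⊗[K] (K ⊗[F] D))`. -/
theorem exists_action (ρ : S →ₐ[K] S ⊗[F] D)
    (hρ : ∀ a b, ρ ((Y : Matrix (Fin r) (Fin r) S) a b) =
        ∑ k, (Y : Matrix (Fin r) (Fin r) S) a k ⊗ₜ (X : Matrix (Fin r) (Fin r) D) k b)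
    (hbij : Function.Bijective
        (Algebra.TensorProduct.lift (includeLeft : S →ₐ[K] S ⊗[F] D) ρ fun _ _ => .all _ _)) :
    ∃ a : specOver K S ⊗ (baseExt F K).obj (specOver F D) ⟶ specOver K S,
      a ≫ pointGL K Y = (pointGL K Y ⊗ₘ ((baseExt F K).map (pointGL F X) ≫ baseExtGL F K r)) ≫
        μ[GLScheme K r] ∧ IsIso (lift (fst _ _) a) := by
  let c : S ⊗[K] (K ⊗[F] D) ≃ₐ[K] S ⊗[F] D := cancelBaseChange F K K S D
  let ρ' : S →ₐ[K] S ⊗[K] (K ⊗[F] D) := c.symm.toAlgHom.comp ρ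
  let α : S ⊗[K] S →ₐ[K] S ⊗[K] (K ⊗[F] D) :=
    Algebra.TensorProduct.lift includeLeft ρ' fun _ _ => .all _ _
  have hα : Function.Bijective α := by
    have : α = c.symm.toAlgHom.comp (Algebra.TensorProduct.lift
      (includeLeft : S →ₐ[K] S ⊗[F] D) ρ fun _ _ => .all _ _) := by
      apply Algebra.TensorProduct.ext
      · ext s
        simp [α, c, Algebra.TensorProduct.one_def]
      · ext s
        simp [α, ρ', ← Algebra.TensorProduct.one_def]
    rw [this]
    exact c.symm.bijective.comp hbij
  have hαr : α.comp includeRight = ρ' := by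
    ext s
    simp [α]
  let e := specOver K S ◁ baseExtSpec F K D
  let T := tensorSpec K S (K ⊗[F] D)
  have hT₁ : inv T ≫ specOverMap (R := K) (includeLeft : S →ₐ[K] S ⊗[K] (K ⊗[F] D)) =
      fst _ _ := by
    rw [IsIso.inv_comp_eq]
    exact (lift_fst _ _).symm
  refine ⟨e ≫ inv T ≫ specOverMap ρ', ?_, ?_⟩
  · have hY : mapGL ρ' Y = mapGL (includeLeft : S →ₐ[K] S ⊗[K] (K ⊗[F] D)) Y *
        mapGL (includeRight : K ⊗[F] D →ₐ[K] S ⊗[K] (K ⊗[F] D))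
          (mapGL (includeRight : D →ₐ[F] K ⊗[F] D) X) :=
      Matrix.GeneralLinearGroup.ext fun a b => by
        simp [ρ', hρ, c, Matrix.mul_apply]
    have key : specOverMap ρ' ≫ pointGL K Y = T ≫ (pointGL K Y ⊗ₘ
        pointGL K (mapGL (includeRight : D →ₐ[F] K ⊗[F] D) X)) ≫ μ[GLScheme K r] := by
      rw [specOverMap_comp_pointGL, hY, ← lift_pointGL_mul, ← specOverMap_comp_pointGL,
        ← specOverMap_comp_pointGL, ← lift_map, Category.assoc]
      rfl
    rw [baseExt_map_comp_baseExtGL, Category.assoc, Category.assoc, key, IsIso.inv_hom_id_assoc]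
    simp only [e, ← id_tensorHom, tensorHom_comp_tensorHom_assoc, Category.id_comp]
  · have : lift (fst _ _) (e ≫ inv T ≫ specOverMap ρ') =
        e ≫ inv T ≫ specOverMap α ≫ tensorSpec K S S := by
      apply CartesianMonoidalCategory.hom_ext
      · rw [lift_fst, Category.assoc, Category.assoc, Category.assoc, tensorSpec, lift_fst,
          specOverMap_comp, lift_comp_includeLeft, hT₁, whiskerLeft_fst]
      · rw [lift_snd, Category.assoc, Category.assoc, Category.assoc, tensorSpec, lift_snd,
          specOverMap_comp, hαr]
    rw [this]
    have := isIso_specOverMap α hα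
    infer_instance

end

/-! ### Geometric properties and group structures -/

theorem isClosedImmersion_specOverMap {R A B : Type u} [CommRing R] [CommRing A] [CommRing B]
    [Algebra R A] [Algebra R B] (f : A →ₐ[R] B) (hf : Function.Surjective f) :
    IsClosedImmersion (specOverMap f).left :=
  IsClosedImmersion.spec_of_surjective (CommRingCat.ofHom f.toRingHom) hf

section

variable {K S : Type u} [Field K] [CommRing S] [Algebra K S]

theorem flat_specOver_hom : Flat (specOver K S).hom :=
  (HasRingHomProperty.Spec_iff (P := @Flat)).mpr
    (RingHom.flat_algebraMap_iff.mpr (inferInstance : Module.Flat K S))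

theorem surjective_specOver_hom [Nontrivial S] : Surjective (specOver K S).hom := by
  constructor
  intro x
  obtain ⟨y⟩ : Nonempty (PrimeSpectrum S) := inferInstance
  exact ⟨y, (inferInstance : Subsingleton (PrimeSpectrum K)).elim _ _⟩

theorem locallyOfFinitePresentation_specOver_hom [Algebra.FiniteType K S] :
    LocallyOfFinitePresentation (specOver K S).hom :=
  (HasRingHomProperty.Spec_iff (P := @LocallyOfFinitePresentation)).mpr
    (RingHom.finitePresentation_algebraMap.mpr
      (Algebra.FinitePresentation.of_finiteType.mp inferInstance))

end

/-- A quotient `D` of `R[X, 1/det X]` to which the comultiplication, counit and antipode descend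
defines a subgroup scheme of `GL_{r/R}`. -/
theorem exists_grpObj {R D : Type u} [CommRing R] [CommRing D] [Algebra R D] {r : ℕ}
    (X : GL (Fin r) D) (hX : Function.Surjective (evalGL (R := R) X))
    (c : D →ₐ[R] D ⊗[R] D)
    (hc : ∀ i j, c ((X : Matrix (Fin r) (Fin r) D) i j) =
      ∑ k, (X : Matrix (Fin r) (Fin r) D) i k ⊗ₜ[R] (X : Matrix (Fin r) (Fin r) D) k j)
    (e : D →ₐ[R] R)
    (he : ∀ i j, e ((X : Matrix (Fin r) (Fin r) D) i j) = (1 : Matrix (Fin r) (Fin r) R) i j)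
    (s : D →ₐ[R] D)
    (hs : ∀ i j, s ((X : Matrix (Fin r) (Fin r) D) i j) =
      ((X⁻¹ : GL (Fin r) D) : Matrix (Fin r) (Fin r) D) i j) :
    ∃ _ : GrpObj (specOver R D), IsMonHom (pointGL R X) := by
  let hopf : HopfAlgebra R D := hopfAlgebraOfSurjective X hX c hc e he s hs
  obtain ⟨f, hf⟩ := exists_bialgHom_evalGL (R := R) X hc he
  have := isMonHom_specOverMap f
  rw [hf] at this
  exact ⟨instGrpObjSpecAsOverSpec, this⟩

theorem isMonHom_baseExt_map_comp_baseExtGL {R S : Type u} [CommRing R] [CommRing S] [Algebra R S]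
    {r : ℕ} {G : Over (Spec (.of R))} [GrpObj G] (j : G ⟶ GLScheme R r) [IsMonHom j] :
    letI : GrpObj ((baseExt R S).obj G) := Functor.grpObjObj
    IsMonHom ((baseExt R S).map j ≫ baseExtGL R S r) := by
  let : GrpObj ((baseExt R S).obj G) := Functor.grpObjObj
  let : GrpObj ((baseExt R S).obj (GLScheme R r)) := Functor.grpObjObj
  have h₁ : IsMonHom ((baseExt R S).map j) := Functor.map.instIsMonHom ..
  have h₂ : IsMonHom (baseExtGL R S r) := isMonHom_baseExtGL R S r
  exact instIsMonHomComp _ _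

end DifferenceGalois

open DifferenceGalois in
theorem theorem4p2p11 {F K L : Type u} [Field F] [Field K] [Field L] [Algebra F K] [Algebra K L]
    [Algebra F L] [IsScalarTower F K L] (σ : L ≃+* L) (hσ : IsSigmaAdmissible F K L σ) (r : ℕ)
    (Φ : GL (Fin r) K) (Ψ : GL (Fin r) L)
    (hΨ : Matrix.GeneralLinearGroup.map (σ : L →+* L) Ψ =
      Matrix.GeneralLinearGroup.map (algebraMap K L) Φ * Ψ) :
    ∃ _ : GrpObj (Gam F K Ψ),
      IsClosedSubgroupScheme (GamIncl F K Ψ) ∧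
      IsClosedImmersion (ZIncl K Ψ).left ∧
      letI : GrpObj ((baseExt F K).obj (Gam F K Ψ)) := Functor.grpObjObj
      ∃ a : Z K Ψ ⊗ (baseExt F K).obj (Gam F K Ψ) ⟶ Z K Ψ,
        a ≫ ZIncl K Ψ = (ZIncl K Ψ ⊗ₘ GamBaseIncl F K Ψ) ≫ μ[GLScheme K r] ∧
        IsRightTorsor ((baseExt F K).obj (Gam F K Ψ)) (Z K Ψ) a := by
  let X : GL (Fin r) (DeltaRing F K Ψ) := mapGL (mu F K Ψ).rangeRestrict (univGL F r)
  have hX : evalGL X = (mu F K Ψ).rangeRestrict :=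
    GLRing.algHom_ext fun i j => evalGL_univGL X i j
  have hXs : Function.Surjective (evalGL (R := F) X) := hX ▸ (mu F K Ψ).rangeRestrict_surjective
  let d : DeltaRing F K Ψ →ₐ[F] L ⊗[K] L := (DeltaRing F K Ψ).val
  have hd : mapGL d X = PsiTilde K Ψ := map_evalGL_univGL (PsiTilde K Ψ)
  have hdi : Function.Injective d := Subtype.val_injective
  have hD := linearIndependent_of_mem_DeltaRing σ hσ Φ Ψ hΨ
  let Y : GL (Fin r) (SigmaRing K Ψ) := mapGL (nu K Ψ).rangeRestrict (univGL K r)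
  have hY : evalGL Y = (nu K Ψ).rangeRestrict :=
    GLRing.algHom_ext fun i j => evalGL_univGL Y i j
  have hYs : Function.Surjective (evalGL (R := K) Y) := hY ▸ (nu K Ψ).rangeRestrict_surjective
  have hYΨ : mapGL (SigmaRing K Ψ).val Y = Ψ := map_evalGL_univGL Ψ
  obtain ⟨c, hc⟩ := exists_comul hXs d Ψ hd hD hdi
  obtain ⟨e, he⟩ := exists_counit hXs d Ψ hd
  obtain ⟨s, hs⟩ := exists_antipode hXs d Ψ hd hdi
  obtain ⟨ρ, hρ, hbij⟩ := exists_coaction hXs d hd hYs (SigmaRing K Ψ).val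
    Subtype.val_injective hYΨ hD
  obtain ⟨a, ha, hiso⟩ := exists_action ρ hρ hbij
  have hGam : pointGL F X = GamIncl F K Ψ := congrArg specOverMap hX
  have hZ : pointGL K Y = ZIncl K Ψ := congrArg specOverMap hY
  rw [hGam, hZ] at ha
  obtain ⟨grp, hmon⟩ : ∃ _ : GrpObj (Gam F K Ψ), IsMonHom (GamIncl F K Ψ) :=
    hGam ▸ exists_grpObj X hXs c hc e he s hs
  have hZc : IsClosedImmersion (ZIncl K Ψ).left :=
    isClosedImmersion_specOverMap _ (nu K Ψ).rangeRestrict_surjective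
  let grpK : GrpObj ((baseExt F K).obj (Gam F K Ψ)) := Functor.grpObjObj
  have hmonK : IsMonHom (GamBaseIncl F K Ψ) :=
    isMonHom_baseExt_map_comp_baseExtGL (GamIncl F K Ψ)
  have hmono : Mono (ZIncl K Ψ) := by
    have : Mono (ZIncl K Ψ).left := inferInstance
    exact Over.mono_of_mono_left _
  have hft : Algebra.FiniteType K (SigmaRing K Ψ) :=
    .of_surjective (nu K Ψ).rangeRestrict (nu K Ψ).rangeRestrict_surjective
  exact ⟨grp, ⟨isClosedImmersion_specOverMap _ (mu F K Ψ).rangeRestrict_surjective, hmon⟩, hZc, a,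
    ha, whiskerLeft_one_comp_action (ZIncl K Ψ) (GamBaseIncl F K Ψ) ha,
    whiskerLeft_mul_comp_action (ZIncl K Ψ) (GamBaseIncl F K Ψ) ha,
    flat_specOver_hom, surjective_specOver_hom, locallyOfFinitePresentation_specOver_hom, hiso⟩
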